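/- Let $m\ge 1$ be an integer. A *tense $m$-symmetric algebra* is an algebra $(L,\vee,\wedge,N,G,H,0,1)$ such that $(L,\vee,\wedge,0,1)$ is a bounded distributive lattice, $N:L\to L$ is a dual endomorphism, i.e. $N(0)=1$, $N(1)=0$, $N(x\wedge y)=N(x)\vee N(y)$, $N(x\vee y)=N(x)\wedge N(y)$, with $N^{2m}(x)=x$ for all $x$, and $G,H:L\to L$ satisfy - (T1) $G(1)=1$ and $H(1)=1$; - (T2) $G(x\wedge y)=G(x)\wedge G(y)$ and $H(x\wedge y)=H(x)\wedge H(y)$; - (T3) $x\le G(N(H(N^{2m-1}(x))))$ and $x\le H(N(G(N^{2m-1}(x))))$. Let $\mathsf{TmS}$ be the category of tense $m$-symmetric algebras and their homomorphisms (maps preserving all the operations and constants). A *Priestley space* is a compact topological space $X$ with a partial order such that whenever $x\not\le y$ there is a clopen increasing set containing $x$ and not $y$; $D(X)$ denotes the family of clopen increasing subsets of $X$. For a relation $R\subseteq X\times X$ put $R^{-1}(y)=\{x\in X:(x,y)\in R\}$; call $R$ *decreasing* if $(x,y)\in R$, $x\le x'$ and $y'\le y$ imply $(x',y')\in R$. A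 *tms-space* is a system $(X,g,R_G,R_H)$ where $X$ is a Priestley space, $g:X\to X$ is continuous and order-reversing, $R_G,R_H\subseteq X\times X$ are decreasing, and - (R1) $R_G^{-1}(y)$ and $R_H^{-1}(y)$ are closed for every $y\in X$; - (R2) for every $U\in D(X)$, the sets $\{y\in X:R_G^{-1}(y)\subseteq U\}$ and $\{y\in X:R_H^{-1}(y)\subseteq U\}$ belong to $D(X)$; - (S1) $g^{2m}(x)=x$ for every $x\in X$; - (S2) $(x,y)\in R_G$ implies $(g(y),g(x))\in R_H$; - (S3) $(x,y)\in R_H$ implies $(g(y),g(x))\in R_G$. A *tms-function* from $(X_1,g_1,R_{G_1},R_{H_1})$ to $(X_2,g_2,R_{G_2},R_{H_2})$ is a continuous order-preserving map $f:X_1\to X_2$ with $f\circ g_1=g_2\circ f$ such that, for $T=G$ and for $T=H$, (i) $(x,y)\in R_{T_1}$ implies $(f(x),f(y))\in R_{T_2}$ for all $x,y\in X_1$, and (ii) for all $z\in X_1$ and $y\in X_2$, if $(y,f(z))\in R_{T_2}$ then there is $x\in X_1$ with $(x,z)\in R_{T_1}$ and $f(x)\le y$. Let $\mathbf{tmS}$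 be the category of tms-spaces and tms-functions. Then the categories $\mathsf{TmS}$ and $\mathbf{tmS}$ are dually equivalent. -/

import Mathlib

open CategoryTheory

universe u

/-- A (bundled) tense `m`-symmetric algebra: a bounded distributive lattice (`0 = 1` allowed)
with a dual endomorphism `N` such that `N^{2m} = id`, and unary operators `G`, `H`
satisfying (T1)-(T3). It is meant for `m ≥ 1`. -/
structure TmS (m : ℕ) : Type (u + 1) where
  carrier : Type u
  [lattice : DistribLattice carrier]
  [bounded : BoundedOrder carrier]
  N : carrier → carrier
  G : carrier → carrier
  H : carrier → carrier
  N_bot : N ⊥ = ⊤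
  N_top : N ⊤ = ⊥
  N_inf : ∀ x y, N (x ⊓ y) = N x ⊔ N y
  N_sup : ∀ x y, N (x ⊔ y) = N x ⊓ N y
  N_iterate : ∀ x, N^[2 * m] x = x
  G_top : G ⊤ = ⊤
  H_top : H ⊤ = ⊤
  G_inf : ∀ x y, G (x ⊓ y) = G x ⊓ G y
  H_inf : ∀ x y, H (x ⊓ y) = H x ⊓ H y
  le_GNHN : ∀ x, x ≤ G (N (H (N^[2 * m - 1] x)))
  le_HNGN : ∀ x, x ≤ H (N (G (N^[2 * m - 1] x)))

namespace TmS

variable {m : ℕ}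

instance : CoeSort (TmS.{u} m) (Type u) := ⟨TmS.carrier⟩

attribute [instance] TmS.lattice TmS.bounded

/-- Homomorphisms: maps preserving `∧`, `∨`, `0`, `1`, `N`, `G`, `H`. -/
@[ext]
structure Hom (A B : TmS.{u} m) : Type u where
  toHom : BoundedLatticeHom A B
  map_N : ∀ x, toHom (A.N x) = B.N (toHom x)
  map_G : ∀ x, toHom (A.G x) = B.G (toHom x)
  map_H : ∀ x, toHom (A.H x) = B.H (toHom x)

/-- The category of tense `m`-symmetric algebras. -/
instance : Category.{u} (TmS.{u} m) where
  Hom A B := Hom A B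
  id A := ⟨BoundedLatticeHom.id A, fun _ => rfl, fun _ => rfl, fun _ => rfl⟩
  comp f g := ⟨g.toHom.comp f.toHom,
    fun x => by simp [f.map_N, g.map_N],
    fun x => by simp [f.map_G, g.map_G],
    fun x => by simp [f.map_H, g.map_H]⟩

end TmS

/-- `boxRel R U = {y : R⁻¹(y) ⊆ U}`, where `R⁻¹(y) = {x : (x, y) ∈ R}`. -/
def boxRel {X : Type u} (R : X → X → Prop) (U : Set X) : Set X :=
  {y | {x | R x y} ⊆ U}

/-- The conditions on each of the two relations of a `gP`-space. `decreasing` is the order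
compatibility of the canonical relations `{(P, F) : T⁻¹(F) ⊆ P}` on prime filters: the sets
`R⁻¹(y)` are increasing and shrink as `y` grows. -/
structure IsGPRelation {X : Type u} [TopologicalSpace X] [PartialOrder X]
    (R : X → X → Prop) : Prop where
  decreasing : ∀ ⦃x x' y y' : X⦄, x ≤ x' → y' ≤ y → R x y → R x' y'
  isClosed_preimage : ∀ y, IsClosed {x | R x y}
  box_mem : ∀ U : Set X, IsClopen U → IsUpperSet U →
    IsClopen (boxRel R U) ∧ IsUpperSet (boxRel R U)

/-- The conditions on a map with respect to one pair of relations in the definition of a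
`gP`-function. -/
structure IsGPMap {X Y : Type u} [PartialOrder Y] (R : X → X → Prop) (S : Y → Y → Prop)
    (f : X → Y) : Prop where
  map_rel : ∀ x y, R x y → S (f x) (f y)
  lift_rel : ∀ (z : X) (y : Y), S y (f z) → ∃ x, R x z ∧ f x ≤ y

/-- A (bundled) `tms`-space: a Priestley space (possibly empty) with a decreasing continuous map
`g` such that `g^{2m} = id`, and two relations making it a `gP`-space, subject to (S2), (S3). -/
structure TmsSpace (m : ℕ) : Type (u + 1) where
  carrier : Type u
  [topology : TopologicalSpace carrier]
  [order : PartialOrder carrier]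
  [compact : CompactSpace carrier]
  [priestley : PriestleySpace carrier]
  g : carrier → carrier
  RG : carrier → carrier → Prop
  RH : carrier → carrier → Prop
  continuous_g : Continuous g
  antitone_g : Antitone g
  isGPRelation_RG : IsGPRelation RG
  isGPRelation_RH : IsGPRelation RH
  g_iterate : ∀ x, g^[2 * m] x = x
  RH_of_RG : ∀ x y, RG x y → RH (g y) (g x)
  RG_of_RH : ∀ x y, RH x y → RG (g y) (g x)

namespace TmsSpace

variable {m : ℕ}

instance : CoeSort (TmsSpace.{u} m) (Type u) := ⟨TmsSpace.carrier⟩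

attribute [instance] TmsSpace.topology TmsSpace.order TmsSpace.compact TmsSpace.priestley

/-- A `tms`-function: an increasing continuous map commuting with `g` (an `OP`-function) which is
also a `gP`-function. -/
@[ext]
structure Hom (X Y : TmsSpace.{u} m) : Type u where
  toFun : X → Y
  continuous_toFun : Continuous toFun
  monotone_toFun : Monotone toFun
  map_g : ∀ x, toFun (X.g x) = Y.g (toFun x)
  isGPMap_RG : IsGPMap X.RG Y.RG toFun
  isGPMap_RH : IsGPMap X.RH Y.RH toFun

end TmsSpace

theorem IsGPMap.id {X : Type u} [PartialOrder X] (R : X → X → Prop) :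
    IsGPMap R R (fun x => x) :=
  ⟨fun _ _ h => h, fun _ y h => ⟨y, h, le_rfl⟩⟩

theorem IsGPMap.comp {X Y Z : Type u} [PartialOrder Y] [PartialOrder Z]
    {R : X → X → Prop} {S : Y → Y → Prop} {T : Z → Z → Prop} {f : X → Y} {k : Y → Z}
    (hk : IsGPMap S T k) (hf : IsGPMap R S f) (hmono : Monotone k) :
    IsGPMap R T (fun x => k (f x)) := by
  refine ⟨fun x y h => hk.map_rel _ _ (hf.map_rel _ _ h), fun z y h => ?_⟩
  obtain ⟨w, hw, hwy⟩ := hk.lift_rel _ _ h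
  obtain ⟨x, hx, hxw⟩ := hf.lift_rel _ _ hw
  exact ⟨x, hx, (hmono hxw).trans hwy⟩

namespace TmsSpace

variable {m : ℕ}

/-- The category of `tms`-spaces. -/
instance : Category.{u} (TmsSpace.{u} m) where
  Hom X Y := Hom X Y
  id X := ⟨fun x => x, continuous_id, monotone_id, fun _ => rfl, IsGPMap.id _, IsGPMap.id _⟩
  comp f k := ⟨fun x => k.toFun (f.toFun x), k.continuous_toFun.comp f.continuous_toFun,
    k.monotone_toFun.comp f.monotone_toFun,
    fun x => by rw [f.map_g, k.map_g],
    k.isGPMap_RG.comp f.isGPMap_RG k.monotone_toFun,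
    k.isGPMap_RH.comp f.isGPMap_RH k.monotone_toFun⟩

end TmsSpace

/-! Priestley duality with operators. Sending a space to its clopen upper sets, with `N(U)` the
complement of `g⁻¹(U)` and `G`, `H` the box operators of the two relations, gives a contravariant
functor; it is shown to be full, faithful and essentially surjective, so no inverse functor or unit
has to be constructed.

Full faithfulness: clopen upper sets separate points, and by compactness each prime filter of them
is a point (`exists_point`), so a lattice homomorphism is preimage under a unique monotone
continuous map. That map respects the relations exactly when preimage commutes with the boxes
(`isGPMap_iff`).

Essential surjectivity: each algebra is isomorphic to the clopen upper sets of its prime spectrum.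
The prime filter theorem gives injectivity of `repr`, compactness gives surjectivity, and
`boxRel_rel` says that the canonical relations recover `G` and `H`. In both directions (T3)
corresponds to (S2) and (S3). -/

namespace ClopenUpperSet

section Lattice

variable {X : Type*} [TopologicalSpace X] [LE X]

theorem mem_sup {U V : ClopenUpperSet X} {x : X} : x ∈ U ⊔ V ↔ x ∈ U ∨ x ∈ V := Iff.rfl

theorem mem_inf {U V : ClopenUpperSet X} {x : X} : x ∈ U ⊓ V ↔ x ∈ U ∧ x ∈ V := Iff.rfl

theorem mem_top (x : X) : x ∈ (⊤ : ClopenUpperSet X) := trivial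

theorem notMem_bot (x : X) : x ∉ (⊥ : ClopenUpperSet X) := id

instance : DistribLattice (ClopenUpperSet X) :=
  { (inferInstance : Lattice (ClopenUpperSet X)) with
    le_sup_inf := fun U V W x hx => by
      simp only [mem_sup, mem_inf] at hx ⊢
      tauto }

end Lattice

/-! ### Separation by clopen upper sets and compactness -/

section Separation

variable {X : Type*} [TopologicalSpace X] [Preorder X] {L : Type*} [DistribLattice L]
  [BoundedOrder L] (S : BoundedLatticeHom L (ClopenUpperSet X))

theorem exists_subset_of_isCompact (hS : ∀ x y : X, ¬x ≤ y → ∃ a, x ∈ S a ∧ y ∉ S a)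
    {K : Set X} (hK : IsCompact K) {y : X} (hy : ∀ x ∈ K, ¬x ≤ y) :
    ∃ a, K ⊆ S a ∧ y ∉ S a := by
  refine hK.induction_on (p := fun s => ∃ a, s ⊆ S a ∧ y ∉ S a) ⟨⊥, Set.empty_subset _, ?_⟩
    ?_ ?_ ?_
  · rw [map_bot]
    exact notMem_bot y
  · rintro s t hst ⟨a, ha, hya⟩
    exact ⟨a, hst.trans ha, hya⟩
  · rintro s t ⟨a, ha, hya⟩ ⟨b, hb, hyb⟩
    refine ⟨a ⊔ b, ?_, ?_⟩ <;> rw [map_sup]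
    · exact Set.union_subset_union ha hb
    · exact fun h => (mem_sup.1 h).elim hya hyb
  · intro x hx
    obtain ⟨a, hxa, hya⟩ := hS x y (hy x hx)
    exact ⟨S a, mem_nhdsWithin_of_mem_nhds ((S a).isClopen.isOpen.mem_nhds hxa), a,
      subset_rfl, hya⟩

/-- For each point outside `W`, some `S a` contains `W` and misses a neighbourhood of that point.
Finitely many such neighbourhoods cover the compact complement of `W`, and the meet of the
corresponding `a` is sent to `W`. -/
theorem surjective_of_separating [CompactSpace X]
    (hS : ∀ x y : X, ¬x ≤ y → ∃ a, x ∈ S a ∧ y ∉ S a) : Function.Surjective S := by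
  intro W
  have key : ∃ a, W ≤ S a ∧ Disjoint (W : Set X)ᶜ (S a : Set X) := by
    refine W.isClopen.compl.isClosed.isCompact.induction_on
      (p := fun s => ∃ a, W ≤ S a ∧ Disjoint s (S a : Set X)) ⟨⊤, ?_, ?_⟩ ?_ ?_ ?_
    · rw [map_top]
      exact le_top
    · exact Set.empty_disjoint _
    · rintro s t hst ⟨a, ha, hsa⟩
      exact ⟨a, ha, hsa.mono_left hst⟩
    · rintro s t ⟨a, ha, hsa⟩ ⟨b, hb, htb⟩
      refine ⟨a ⊓ b, ?_, ?_⟩ <;> rw [map_inf]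
      · exact le_inf ha hb
      · rw [Set.disjoint_union_left]
        exact ⟨hsa.mono_right fun _ h => h.1, htb.mono_right fun _ h => h.2⟩
    · intro y hy
      obtain ⟨a, hWa, hya⟩ := exists_subset_of_isCompact S hS W.isClopen.isClosed.isCompact
        (y := y) fun x hx hxy => hy (W.upper hxy hx)
      exact ⟨(S a : Set X)ᶜ,
        mem_nhdsWithin_of_mem_nhds ((S a).isClopen.compl.isOpen.mem_nhds hya), a, hWa,
        disjoint_compl_left⟩
  obtain ⟨a, ha, hd⟩ := key
  refine ⟨a, le_antisymm (fun x hx => ?_) ha⟩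
  by_contra hxW
  exact Set.disjoint_left.1 hd hxW hx

theorem exists_mem_of_not_le [PriestleySpace X] {x y : X} (h : ¬x ≤ y) :
    ∃ U : ClopenUpperSet X, x ∈ U ∧ y ∉ U := by
  obtain ⟨U, hU, hU', hx, hy⟩ := exists_isClopen_upper_of_not_le h
  exact ⟨⟨⟨U, hU⟩, hU'⟩, hx, hy⟩

theorem le_iff_forall_mem [PriestleySpace X] {x y : X} :
    x ≤ y ↔ ∀ U : ClopenUpperSet X, x ∈ U → y ∈ U := by
  refine ⟨fun h U hx => U.upper h hx, fun h => ?_⟩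
  by_contra hxy
  obtain ⟨U, hx, hy⟩ := exists_mem_of_not_le hxy
  exact hy (h U hx)

theorem exists_superset_of_isCompact [PriestleySpace X] {K : Set X} (hK : IsCompact K) {y : X}
    (hy : ∀ x ∈ K, ¬x ≤ y) : ∃ U : ClopenUpperSet X, K ⊆ U ∧ y ∉ U :=
  exists_subset_of_isCompact (BoundedLatticeHom.id (ClopenUpperSet X))
    (fun _ _ => exists_mem_of_not_le) hK hy

end Separation

/-! ### Points as prime filters, and maps of spaces -/

section Points

theorem eq_of_forall_mem_iff {X : Type*} [TopologicalSpace X] [PartialOrder X] [PriestleySpace X]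
    {x y : X} (h : ∀ U : ClopenUpperSet X, x ∈ U ↔ y ∈ U) : x = y :=
  le_antisymm (le_iff_forall_mem.2 fun U => (h U).1) (le_iff_forall_mem.2 fun U => (h U).2)

/-- In a compact space, every prime filter of clopen upper sets is given by a point. -/
theorem exists_point {X : Type*} [TopologicalSpace X] [Preorder X] [CompactSpace X]
    (P : ClopenUpperSet X → Prop) (top : P ⊤) (bot : ¬P ⊥)
    (inf : ∀ U V, P (U ⊓ V) ↔ P U ∧ P V) (sup : ∀ U V, P (U ⊔ V) ↔ P U ∨ P V) :
    ∃ x, ∀ U, x ∈ U ↔ P U := by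
  -- A point realizing `P` is one lying in every `U \ V` with `P U` and `¬P V`. These closed sets
  -- are directed, and nonempty because `U ≤ V` would force `P V`.
  let ι := {U : ClopenUpperSet X // P U} × {U : ClopenUpperSet X // ¬P U}
  let t : ι → Set X := fun i => (i.1.1 : Set X) \ i.2.1
  have hcl : ∀ i, IsClosed (t i) := fun i => (i.1.1.isClopen.diff i.2.1.isClopen).isClosed
  have : Nonempty ι := ⟨⟨⟨⊤, top⟩, ⟨⊥, bot⟩⟩⟩
  obtain ⟨x, hx⟩ := IsCompact.nonempty_iInter_of_directed_nonempty_isCompact_isClosed t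
    (fun i j => ⟨⟨⟨i.1.1 ⊓ j.1.1, (inf _ _).2 ⟨i.1.2, j.1.2⟩⟩,
      ⟨i.2.1 ⊔ j.2.1, fun h => ((sup _ _).1 h).elim i.2.2 j.2.2⟩⟩,
      fun _ h => ⟨h.1.1, fun h' => h.2 (Or.inl h')⟩,
      fun _ h => ⟨h.1.2, fun h' => h.2 (Or.inr h')⟩⟩)
    (fun i => by
      by_contra h
      rw [Set.not_nonempty_iff_eq_empty, Set.sdiff_eq_empty] at h
      have h' : i.1.1 ⊓ i.2.1 = i.1.1 := inf_eq_left.2 h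
      exact i.2.2 ((inf _ _).1 (h' ▸ i.1.2)).2)
    (fun i => (hcl i).isCompact) hcl
  rw [Set.mem_iInter] at hx
  refine ⟨x, fun U => ⟨fun hU => ?_, fun hU => (hx ⟨⟨U, hU⟩, ⟨⊥, bot⟩⟩).1⟩⟩
  by_contra h
  exact (hx ⟨⟨⊤, top⟩, ⟨U, h⟩⟩).2 hU

theorem continuous_of_isClopen_preimage {X Y : Type*} [TopologicalSpace X] [TopologicalSpace Y]
    [PartialOrder Y] [CompactSpace Y] [PriestleySpace Y] {f : X → Y}
    (hf : ∀ U : ClopenUpperSet Y, IsClopen (f ⁻¹' U)) : Continuous f := by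
  refine continuous_def.2 fun O hO => isOpen_iff_mem_nhds.2 fun x hx => ?_
  have key : ∃ V : Set Y, IsOpen (f ⁻¹' V) ∧ f x ∈ V ∧ Disjoint Oᶜ V := by
    refine hO.isClosed_compl.isCompact.induction_on
      (p := fun s => ∃ V : Set Y, IsOpen (f ⁻¹' V) ∧ f x ∈ V ∧ Disjoint s V)
      ⟨Set.univ, isOpen_univ, trivial, Set.empty_disjoint _⟩ ?_ ?_ ?_
    · rintro s t hst ⟨V, hV, hxV, hd⟩
      exact ⟨V, hV, hxV, hd.mono_left hst⟩
    · rintro s t ⟨V, hV, hxV, hd⟩ ⟨W, hW, hxW, hd'⟩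
      refine ⟨V ∩ W, hV.inter hW, ⟨hxV, hxW⟩, Set.disjoint_union_left.2
        ⟨hd.mono_right Set.inter_subset_left, hd'.mono_right Set.inter_subset_right⟩⟩
    · intro y hy
      have hne : f x ≠ y := fun h => hy (h ▸ hx)
      obtain ⟨V, hV, hVm, hxV, hyV⟩ := exists_isClopen_upper_or_lower_of_ne hne
      refine ⟨Vᶜ, mem_nhdsWithin_of_mem_nhds (hV.compl.isOpen.mem_nhds hyV), V, ?_, hxV,
        disjoint_compl_left⟩
      rcases hVm with hu | hl
      · exact (hf ⟨⟨V, hV⟩, hu⟩).isOpen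
      · have := (hf ⟨⟨Vᶜ, hV.compl⟩, hl.compl⟩).compl.isOpen
        rwa [← Set.preimage_compl, ClopenUpperSet.coe_mk, TopologicalSpace.Clopens.coe_mk,
          compl_compl] at this
  obtain ⟨V, hV, hxV, hd⟩ := key
  refine Filter.mem_of_superset (hV.mem_nhds hxV) fun z hz => ?_
  by_contra h
  exact Set.disjoint_left.1 hd h hz

/-- The preimage of a clopen upper set under a monotone continuous map. -/
def comap {X Y : Type*} [TopologicalSpace X] [TopologicalSpace Y] [Preorder X] [Preorder Y]
    (f : X → Y) (hf : Continuous f) (hm : Monotone f) :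
    BoundedLatticeHom (ClopenUpperSet Y) (ClopenUpperSet X) where
  toFun U := ⟨⟨f ⁻¹' U, U.isClopen.preimage hf⟩, U.upper.preimage hm⟩
  map_sup' _ _ := rfl
  map_inf' _ _ := rfl
  map_top' := rfl
  map_bot' := rfl

/-- The complement of the preimage of a clopen upper set under an antitone continuous map. -/
def complComap {X Y : Type*} [TopologicalSpace X] [TopologicalSpace Y] [Preorder X] [Preorder Y]
    (g : X → Y) (hg : Continuous g) (ha : Antitone g) (U : ClopenUpperSet Y) :
    ClopenUpperSet X :=
  ⟨⟨(g ⁻¹' U)ᶜ, (U.isClopen.preimage hg).compl⟩, fun _ _ h hx hy => hx (U.upper (ha h) hy)⟩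

theorem mem_complComap {X Y : Type*} [TopologicalSpace X] [TopologicalSpace Y] [Preorder X]
    [Preorder Y] {g : X → Y} {hg : Continuous g} {ha : Antitone g} {U : ClopenUpperSet Y}
    {x : X} : x ∈ complComap g hg ha U ↔ g x ∉ U := Iff.rfl

theorem complComap_bot {X Y : Type*} [TopologicalSpace X] [TopologicalSpace Y] [Preorder X]
    [Preorder Y] {g : X → Y} (hg : Continuous g) (ha : Antitone g) :
    complComap g hg ha ⊥ = ⊤ :=
  SetLike.ext fun _ => by
    simp only [mem_complComap, mem_top, notMem_bot, not_false_eq_true]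

theorem complComap_top {X Y : Type*} [TopologicalSpace X] [TopologicalSpace Y] [Preorder X]
    [Preorder Y] {g : X → Y} (hg : Continuous g) (ha : Antitone g) :
    complComap g hg ha ⊤ = ⊥ :=
  SetLike.ext fun _ => by
    simp only [mem_complComap, mem_top, notMem_bot, not_true_eq_false]

end Points

end ClopenUpperSet

/-! ### Relations and their box operators -/

namespace IsGPRelation

variable {X Y : Type u} [TopologicalSpace X] [PartialOrder X] [TopologicalSpace Y]
  [PartialOrder Y] {R : X → X → Prop} {S : Y → Y → Prop}

/-- The operator on clopen upper sets induced by a relation. -/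
def box (hR : IsGPRelation R) (U : ClopenUpperSet X) : ClopenUpperSet X :=
  ⟨⟨boxRel R U, (hR.box_mem U U.isClopen U.upper).1⟩, (hR.box_mem U U.isClopen U.upper).2⟩

theorem mem_box {hR : IsGPRelation R} {U : ClopenUpperSet X} {y : X} :
    y ∈ hR.box U ↔ ∀ x, R x y → x ∈ U := Iff.rfl

theorem box_top (hR : IsGPRelation R) : hR.box ⊤ = ⊤ :=
  SetLike.ext fun _ => ⟨fun _ => trivial, fun _ _ _ => trivial⟩

theorem box_inf (hR : IsGPRelation R) (U V : ClopenUpperSet X) :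
    hR.box (U ⊓ V) = hR.box U ⊓ hR.box V :=
  SetLike.ext fun y => by
    simp only [mem_box, ClopenUpperSet.mem_inf, ← forall_and]

/-- A relation is recovered from its box operator: `R⁻¹(y)` is a closed upper set, hence an
intersection of clopen upper sets. -/
theorem rel_iff_forall_mem_box [CompactSpace X] [PriestleySpace X] (hR : IsGPRelation R)
    {x y : X} : R x y ↔ ∀ U, y ∈ hR.box U → x ∈ U := by
  refine ⟨fun h U hU => hU h, fun h => ?_⟩
  by_contra hxy
  obtain ⟨U, hU, hxU⟩ := ClopenUpperSet.exists_superset_of_isCompact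
    (hR.isClosed_preimage y).isCompact (y := x)
    fun z hz hzx => hxy (hR.decreasing hzx le_rfl hz)
  exact hxU (h U hU)

/-- Preservation of the relation gives one inclusion between the two sides, the lifting condition
the other. Conversely, if lifting fails at `z` and `y`, a clopen upper set containing the compact
image of `R⁻¹(z)` but not `y` violates the equation. -/
theorem isGPMap_iff [CompactSpace X] [CompactSpace Y] [PriestleySpace Y]
    (hR : IsGPRelation R) (hS : IsGPRelation S) {f : X → Y} (hf : Continuous f)
    (hm : Monotone f) : IsGPMap R S f ↔
      ∀ U, ClopenUpperSet.comap f hf hm (hS.box U) = hR.box (ClopenUpperSet.comap f hf hm U) := by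
  constructor
  · intro h U
    refine SetLike.ext fun z => ⟨fun hz x hx => mem_box (hR := hS).1 hz _ (h.map_rel x z hx),
      fun hz y hy => ?_⟩
    obtain ⟨x, hx, hxy⟩ := h.lift_rel z y hy
    exact U.upper hxy (mem_box.1 hz x hx)
  · intro h
    refine ⟨fun x y hxy => hS.rel_iff_forall_mem_box.2 fun U hU => ?_, fun z y hy => ?_⟩
    · have : y ∈ hR.box (ClopenUpperSet.comap f hf hm U) := h U ▸ hU
      exact this hxy
    · by_contra! hc
      obtain ⟨U, hU, hyU⟩ := ClopenUpperSet.exists_superset_of_isCompact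
        ((hR.isClosed_preimage z).isCompact.image hf) (y := y)
        (by rintro _ ⟨x, hx, rfl⟩; exact hc x hx)
      have : z ∈ ClopenUpperSet.comap f hf hm (hS.box U) :=
        h U ▸ fun x hx => hU ⟨x, hx, rfl⟩
      exact hyU (this hy)

end IsGPRelation

/-! ### The functor of clopen upper sets is fully faithful -/

namespace TmsSpace

variable {m : ℕ} {X Y : TmsSpace.{u} m}

theorem mem_iterate_complComap (X : TmsSpace.{u} m) (k : ℕ) (U : ClopenUpperSet X) (x : X) :
    x ∈ (ClopenUpperSet.complComap X.g X.continuous_g X.antitone_g)^[2 * k] U ↔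
      X.g^[2 * k] x ∈ U := by
  induction k generalizing x with
  | zero => rfl
  | succ k ih =>
    rw [Nat.mul_succ, Function.iterate_succ_apply', Function.iterate_succ_apply',
      ClopenUpperSet.mem_complComap, ClopenUpperSet.mem_complComap, not_not, ih,
      Function.iterate_add_apply]
    rfl

theorem iterate_complComap (X : TmsSpace.{u} m) (U : ClopenUpperSet X) :
    (ClopenUpperSet.complComap X.g X.continuous_g X.antitone_g)^[2 * m] U = U :=
  SetLike.ext fun x => by rw [mem_iterate_complComap, X.g_iterate]

theorem le_box_complComap (hm : 1 ≤ m) (X : TmsSpace.{u} m) {R S : X → X → Prop}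
    (hR : IsGPRelation R) (hS : IsGPRelation S) (hRS : ∀ x y, R x y → S (X.g y) (X.g x))
    (U : ClopenUpperSet X) :
    U ≤ hR.box (ClopenUpperSet.complComap X.g X.continuous_g X.antitone_g
      (hS.box ((ClopenUpperSet.complComap X.g X.continuous_g X.antitone_g)^[2 * m - 1] U))) := by
  intro y hy x hx h
  have hgy := IsGPRelation.mem_box (hR := hS).1 h _ (hRS x y hx)
  -- Writing `U` as `N(N^{2m-1}(U))` turns `y ∈ U` into `g y ∉ N^{2m-1}(U)`, contradicting `hgy`.
  -- The truncated subtraction is harmless since `m ≥ 1`.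
  rw [← iterate_complComap X U, ← Nat.sub_add_cancel (show 1 ≤ 2 * m by omega),
    Function.iterate_succ_apply'] at hy
  exact hy hgy

/-- The algebra of clopen upper sets of a `tms`-space. -/
def clopenAlgebra (hm : 1 ≤ m) (X : TmsSpace.{u} m) : TmS.{u} m where
  carrier := ClopenUpperSet X
  N := ClopenUpperSet.complComap X.g X.continuous_g X.antitone_g
  G := X.isGPRelation_RG.box
  H := X.isGPRelation_RH.box
  N_bot := ClopenUpperSet.complComap_bot _ _
  N_top := ClopenUpperSet.complComap_top _ _
  N_inf U V := SetLike.ext (p := U ⊓ V |> ClopenUpperSet.complComap X.g _ _) fun _ => not_and_or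
  N_sup U V := SetLike.ext (p := U ⊔ V |> ClopenUpperSet.complComap X.g _ _) fun _ => not_or
  N_iterate := X.iterate_complComap
  G_top := X.isGPRelation_RG.box_top
  H_top := X.isGPRelation_RH.box_top
  G_inf := X.isGPRelation_RG.box_inf
  H_inf := X.isGPRelation_RH.box_inf
  le_GNHN := X.le_box_complComap hm X.isGPRelation_RG X.isGPRelation_RH X.RH_of_RG
  le_HNGN := X.le_box_complComap hm X.isGPRelation_RH X.isGPRelation_RG X.RG_of_RH

/-- The homomorphism of algebras of clopen upper sets given by taking preimages. -/
def clopenAlgebraMap (hm : 1 ≤ m) (f : Hom X Y) :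
    TmS.Hom (clopenAlgebra hm Y) (clopenAlgebra hm X) where
  toHom := ClopenUpperSet.comap f.toFun f.continuous_toFun f.monotone_toFun
  map_N U := ClopenUpperSet.ext <| Set.ext fun x => by
    change ¬Y.g (f.toFun x) ∈ (show ClopenUpperSet Y from U) ↔
      ¬f.toFun (X.g x) ∈ (show ClopenUpperSet Y from U)
    rw [f.map_g]
  map_G := (IsGPRelation.isGPMap_iff X.isGPRelation_RG Y.isGPRelation_RG
    f.continuous_toFun f.monotone_toFun).1 f.isGPMap_RG
  map_H := (IsGPRelation.isGPMap_iff X.isGPRelation_RH Y.isGPRelation_RH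
    f.continuous_toFun f.monotone_toFun).1 f.isGPMap_RH

/-- The contravariant functor of clopen upper sets, as a functor to the opposite category. -/
def clopenFunctor (hm : 1 ≤ m) : TmsSpace.{u} m ⥤ (TmS.{u} m)ᵒᵖ where
  obj X := Opposite.op (clopenAlgebra hm X)
  map f := Quiver.Hom.op (clopenAlgebraMap hm f)
  map_id _ := rfl
  map_comp _ _ := rfl

theorem clopenAlgebraMap_injective (hm : 1 ≤ m) :
    Function.Injective (clopenAlgebraMap hm : Hom X Y → _) := by
  intro f k h
  refine Hom.ext (funext fun x => ClopenUpperSet.eq_of_forall_mem_iff fun U => ?_)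
  have hU := DFunLike.congr_fun (congrArg TmS.Hom.toHom h) U
  exact SetLike.ext_iff (A := ClopenUpperSet X) |>.1 hU x

/-- The sets `U` with `x ∈ ψ U` form a prime filter, hence come from a point `f x`; then `ψ` is
preimage under `f`, and compatibility of `ψ` with the operators transfers to `f`. -/
theorem clopenAlgebraMap_surjective (hm : 1 ≤ m) :
    Function.Surjective (clopenAlgebraMap hm : Hom X Y → _) := by
  intro φ
  let ψ : BoundedLatticeHom (ClopenUpperSet Y) (ClopenUpperSet X) := φ.toHom
  have hpt : ∀ x : X, ∃ y : Y, ∀ U, y ∈ U ↔ x ∈ ψ U := fun x =>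
    ClopenUpperSet.exists_point (fun U => x ∈ ψ U)
      (by rw [map_top]; trivial) (by rw [map_bot]; exact id)
      (fun U V => by rw [map_inf]; rfl) (fun U V => by rw [map_sup]; rfl)
  choose f hf using hpt
  have hcont : Continuous f := ClopenUpperSet.continuous_of_isClopen_preimage fun U => by
    rw [show f ⁻¹' U = ψ U from Set.ext fun x => hf x U]
    exact (ψ U).isClopen
  have hmono : Monotone f := fun x y hxy => ClopenUpperSet.le_iff_forall_mem.2 fun U hU =>
    (hf y U).2 ((ψ U).upper hxy ((hf x U).1 hU))
  have hcomap : ∀ U, ClopenUpperSet.comap f hcont hmono U = ψ U :=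
    fun U => SetLike.ext fun x => hf x U
  refine ⟨⟨f, hcont, hmono, fun x => ClopenUpperSet.eq_of_forall_mem_iff fun U => ?_,
    (IsGPRelation.isGPMap_iff X.isGPRelation_RG Y.isGPRelation_RG hcont hmono).2 fun U => ?_,
    (IsGPRelation.isGPMap_iff X.isGPRelation_RH Y.isGPRelation_RH hcont hmono).2 fun U => ?_⟩,
    TmS.Hom.ext (BoundedLatticeHom.ext hcomap)⟩
  · have h : x ∈ ψ (ClopenUpperSet.complComap Y.g Y.continuous_g Y.antitone_g U) ↔
        X.g x ∉ ψ U := SetLike.ext_iff (A := ClopenUpperSet X) |>.1 (φ.map_N U) x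
    rw [← hf, ← hf, ClopenUpperSet.mem_complComap, not_iff_not] at h
    exact h.symm
  · rw [hcomap, hcomap]
    exact φ.map_G U
  · rw [hcomap, hcomap]
    exact φ.map_H U

instance (hm : 1 ≤ m) : (clopenFunctor.{u} hm).Faithful where
  map_injective h := clopenAlgebraMap_injective hm (congrArg Quiver.Hom.unop h)

instance (hm : 1 ≤ m) : (clopenFunctor.{u} hm).Full where
  map_surjective φ := (clopenAlgebraMap_surjective hm φ.unop).imp
    fun _ h => Quiver.Hom.unop_inj h

end TmsSpace

/-! ### The prime spectrum and the representation of lattices -/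

/-- The prime spectrum of a bounded distributive lattice; a prime filter is represented by its
characteristic homomorphism. -/
def LatticeSpectrum (L : Type*) [DistribLattice L] [BoundedOrder L] : Type _ :=
  BoundedLatticeHom L Bool

namespace LatticeSpectrum

variable {L : Type*} [DistribLattice L] [BoundedOrder L]

/-- The characteristic function of a prime filter. -/
def char (p : LatticeSpectrum L) : L → Bool := p.toFun

theorem char_injective : Function.Injective (char : LatticeSpectrum L → L → Bool) :=
  fun _ _ h => DFunLike.coe_injective (F := BoundedLatticeHom L Bool) h

@[simp] theorem char_sup (p : LatticeSpectrum L) (a b : L) :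
    p.char (a ⊔ b) = (p.char a || p.char b) := p.map_sup' a b

@[simp] theorem char_inf (p : LatticeSpectrum L) (a b : L) :
    p.char (a ⊓ b) = (p.char a && p.char b) := p.map_inf' a b

@[simp] theorem char_top (p : LatticeSpectrum L) : p.char ⊤ = true := p.map_top'

@[simp] theorem char_bot (p : LatticeSpectrum L) : p.char ⊥ = false := p.map_bot'

theorem char_mono (p : LatticeSpectrum L) {a b : L} (h : a ≤ b) (ha : p.char a = true) :
    p.char b = true := by
  rw [← sup_eq_right.2 h, char_sup, ha, Bool.true_or]

instance : PartialOrder (LatticeSpectrum L) := PartialOrder.lift char char_injective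

theorem le_iff {p q : LatticeSpectrum L} :
    p ≤ q ↔ ∀ a, p.char a = true → q.char a = true := Iff.rfl

instance : TopologicalSpace (LatticeSpectrum L) := TopologicalSpace.induced char inferInstance

theorem continuous_char (a : L) : Continuous fun p : LatticeSpectrum L => p.char a :=
  (continuous_apply a).comp continuous_induced_dom

theorem continuous_iff {X : Type*} [TopologicalSpace X] {f : X → LatticeSpectrum L} :
    Continuous f ↔ ∀ a, Continuous fun x => (f x).char a :=
  continuous_induced_rng.trans continuous_pi_iff

/-- Being a homomorphism is a family of conditions on finitely many coordinates each, so the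
spectrum is closed in the compact space `L → Bool`. -/
theorem range_char : Set.range (char : LatticeSpectrum L → L → Bool) =
    {f | (∀ a b, f (a ⊔ b) = (f a || f b)) ∧ (∀ a b, f (a ⊓ b) = (f a && f b)) ∧
      f ⊤ = true ∧ f ⊥ = false} := by
  ext f
  constructor
  · rintro ⟨p, rfl⟩
    exact ⟨p.char_sup, p.char_inf, p.char_top, p.char_bot⟩
  · rintro ⟨hs, hi, ht, hb⟩
    exact ⟨⟨⟨⟨f, hs⟩, hi⟩, ht, hb⟩, rfl⟩

instance : CompactSpace (LatticeSpectrum L) := by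
  refine Topology.IsClosedEmbedding.compactSpace (f := char)
    ⟨⟨⟨rfl⟩, char_injective⟩, ?_⟩
  rw [range_char]
  simp only [Set.ofPred_and, Set.ofPred_forall]
  have hc : ∀ a : L, Continuous fun f : L → Bool => f a := continuous_apply
  have h₂ : ∀ {k : Bool × Bool → Bool}, Continuous k := continuous_of_discreteTopology
  refine (isClosed_iInter fun a => isClosed_iInter fun b => ?_).inter
    ((isClosed_iInter fun a => isClosed_iInter fun b => ?_).inter
      ((isClosed_eq (hc _) continuous_const).inter (isClosed_eq (hc _) continuous_const)))
  · exact isClosed_eq (hc _) ((h₂ (k := fun x => x.1 || x.2)).comp ((hc a).prodMk (hc b)))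
  · exact isClosed_eq (hc _) ((h₂ (k := fun x => x.1 && x.2)).comp ((hc a).prodMk (hc b)))

theorem isClopen_setOf_char (a : L) : IsClopen {p : LatticeSpectrum L | p.char a = true} :=
  (isClopen_discrete {true}).preimage (continuous_char a)

/-- The representation of a bounded distributive lattice by clopen upper sets of its spectrum. -/
def repr : BoundedLatticeHom L (ClopenUpperSet (LatticeSpectrum L)) where
  toFun a := ⟨⟨{p | p.char a = true}, isClopen_setOf_char a⟩, fun _ _ h => h a⟩
  map_sup' a b := SetLike.ext fun p =>
    (Bool.eq_iff_iff.1 (p.char_sup a b) |>.trans (Bool.or_eq_true_iff))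
  map_inf' a b := SetLike.ext fun p =>
    (Bool.eq_iff_iff.1 (p.char_inf a b) |>.trans (Bool.and_eq_true_iff))
  map_top' := SetLike.ext fun p => ⟨fun _ => trivial, fun _ => p.char_top⟩
  map_bot' := SetLike.ext fun p =>
    ⟨fun h => Bool.false_ne_true (p.char_bot.symm.trans h), fun h => h.elim⟩

theorem mem_repr {a : L} {p : LatticeSpectrum L} : p ∈ repr a ↔ p.char a = true := Iff.rfl

theorem exists_mem_repr_of_not_le (p q : LatticeSpectrum L) (h : ¬p ≤ q) :
    ∃ a, p ∈ repr a ∧ q ∉ repr a := by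
  rw [le_iff] at h
  push Not at h
  exact h

instance : PriestleySpace (LatticeSpectrum L) where
  priestley {p q} h := by
    obtain ⟨a, hp, hq⟩ := exists_mem_repr_of_not_le p q h
    exact ⟨repr a, (repr a).isClopen, (repr a).upper, hp, hq⟩

theorem repr_surjective : Function.Surjective (repr : BoundedLatticeHom L _) :=
  ClopenUpperSet.surjective_of_separating repr exists_mem_repr_of_not_le

/-- The prime filter theorem: a filter extends to a prime filter avoiding a given element
outside the filter. -/
theorem exists_char_of_notMem (F : Order.PFilter L) {a : L} (ha : a ∉ F) :
    ∃ p : LatticeSpectrum L, (∀ b ∈ F, p.char b = true) ∧ p.char a = false := by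
  classical
  obtain ⟨J, hJ, haJ, hFJ⟩ := DistribLattice.prime_ideal_of_disjoint_filter_ideal
    (F := F) (I := Order.Ideal.principal a)
    (Set.disjoint_left.2 fun b hb hba => ha (Order.PFilter.mem_of_le hba hb))
  refine ⟨⟨⟨⟨fun b => decide (b ∉ J), fun b c => ?_⟩, fun b c => ?_⟩, ?_, ?_⟩, fun b hb => ?_, ?_⟩
  · change decide _ = (decide _ || decide _)
    rw [← Bool.decide_or, decide_eq_decide, Order.Ideal.sup_mem_iff, not_and_or]
  · change decide _ = (decide _ && decide _)
    rw [← Bool.decide_and, decide_eq_decide, ← not_or, not_iff_not]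
    exact ⟨hJ.mem_or_mem, fun h => h.elim (J.lower inf_le_left) (J.lower inf_le_right)⟩
  · exact decide_eq_true hJ.toIsProper.top_notMem
  · exact decide_eq_false (not_not.2 J.bot_mem)
  · exact decide_eq_true (Set.disjoint_left.1 hFJ hb)
  · exact decide_eq_false (not_not.2 (haJ (Order.Ideal.mem_principal_self)))

theorem repr_injective : Function.Injective (repr : BoundedLatticeHom L _) := by
  have key : ∀ a b : L, repr a ≤ repr b → a ≤ b := fun a b h => by
    by_contra hab
    obtain ⟨p, hp, hb⟩ := exists_char_of_notMem (Order.PFilter.principal a) (a := b) hab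
    have := h (mem_repr.2 (hp a (Order.PFilter.mem_principal.2 le_rfl)))
    rw [mem_repr, hb] at this
    exact Bool.false_ne_true this
  exact fun a b h => le_antisymm (key a b h.le) (key b a h.ge)

section Relation

variable (T : L → L)

/-- The canonical relation `{(P, F) : T⁻¹(F) ⊆ P}` on prime filters. -/
def rel (p q : LatticeSpectrum L) : Prop := ∀ a, q.char (T a) = true → p.char a = true

variable {T} (hT : T ⊤ = ⊤) (hT' : ∀ a b, T (a ⊓ b) = T a ⊓ T b)
include hT hT'

/-- Since `T` preserves finite meets, `T⁻¹(q)` is a filter; it omits `a`, so it extends to a prime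
filter omitting `a`. -/
theorem exists_rel_of_char_eq_false {q : LatticeSpectrum L} {a : L}
    (h : q.char (T a) = false) : ∃ p, rel T p q ∧ p.char a = false := by
  have hF : Order.IsPFilter {b | q.char (T b) = true} := by
    refine Order.IsPFilter.of_def ⟨⊤, by simp [hT]⟩
      (fun b hb c hc => ⟨b ⊓ c, by simp_all, inf_le_left, inf_le_right⟩) fun {b c} hbc hb => ?_
    have : T b = T b ⊓ T c := by rw [← hT', inf_eq_left.2 hbc]
    exact q.char_mono (inf_eq_left.1 this.symm) hb
  obtain ⟨p, hp, hpa⟩ := exists_char_of_notMem hF.toPFilter (a := a) fun ha =>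
    Bool.false_ne_true (h.symm.trans ha)
  exact ⟨p, hp, hpa⟩

theorem boxRel_rel (a : L) :
    boxRel (rel T) (repr a : Set (LatticeSpectrum L)) = (repr (T a) : Set (LatticeSpectrum L)) := by
  ext q
  refine ⟨fun h => ?_, fun h p hp => hp a h⟩
  by_contra hq
  obtain ⟨p, hp, hpa⟩ := exists_rel_of_char_eq_false hT hT' (Bool.eq_false_of_not_eq_true hq)
  exact Bool.false_ne_true (hpa.symm.trans (h hp))

theorem isGPRelation_rel : IsGPRelation (rel T) where
  decreasing p p' q q' hp hq h a ha := hp a (h a (hq _ ha))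
  isClosed_preimage q := by
    simp only [rel, Set.ofPred_forall]
    exact isClosed_iInter fun a => isClosed_iInter fun _ => (isClopen_setOf_char a).isClosed
  box_mem U hU hU' := by
    -- Every clopen upper set is some `repr a`, whose box is `repr (T a)`.
    obtain ⟨a, ha⟩ := repr_surjective ⟨⟨U, hU⟩, hU'⟩
    have : (repr a : Set (LatticeSpectrum L)) = U := congrArg _ ha
    rw [← this, boxRel_rel hT hT']
    exact ⟨(repr (T a)).isClopen, (repr (T a)).upper⟩

theorem box_repr (a : L) : (isGPRelation_rel hT hT').box (repr a) = repr (T a) :=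
  ClopenUpperSet.ext (boxRel_rel hT hT' a)

end Relation

end LatticeSpectrum

/-! ### The spectrum of an algebra and essential surjectivity -/

namespace TmS

variable {m : ℕ}

/-- The action of the dual endomorphism on prime filters: `g(P) = {a : N(a) ∉ P}`. -/
def specMap (A : TmS.{u} m) (p : LatticeSpectrum A) : LatticeSpectrum A where
  toFun a := !p.char (A.N a)
  map_sup' a b := by simp [A.N_sup, Bool.not_and]
  map_inf' a b := by simp [A.N_inf, Bool.not_or]
  map_top' := by simp [A.N_top]
  map_bot' := by simp [A.N_bot]

theorem char_specMap (A : TmS.{u} m) (p : LatticeSpectrum A) (a : A) :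
    (A.specMap p).char a = !p.char (A.N a) := rfl

theorem char_iterate_specMap (A : TmS.{u} m) (k : ℕ) (p : LatticeSpectrum A) (a : A) :
    (A.specMap^[2 * k] p).char a = p.char (A.N^[2 * k] a) := by
  induction k generalizing a with
  | zero => rfl
  | succ k ih =>
    rw [Nat.mul_succ, Function.iterate_succ_apply', Function.iterate_succ_apply', char_specMap,
      char_specMap, Bool.not_not, ih, Function.iterate_add_apply]
    rfl

theorem rel_specMap (hm : 1 ≤ m) (A : TmS.{u} m) {S T : A → A}
    (h : ∀ a, a ≤ S (A.N (T (A.N^[2 * m - 1] a)))) (p q : LatticeSpectrum A)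
    (hpq : LatticeSpectrum.rel S p q) :
    LatticeSpectrum.rel T (A.specMap q) (A.specMap p) := by
  intro a ha
  rw [char_specMap] at ha ⊢
  rw [Bool.not_eq_true'] at ha ⊢
  by_contra hq
  -- At `N a` the inner term `N^{2m-1}(N a)` collapses to `a`, giving `N a ≤ S (N (T a))`; so `N a ∈
  -- q` would put `N (T a)` in `p`.
  have := h (A.N a)
  rw [← Function.iterate_succ_apply, Nat.succ_eq_add_one, Nat.sub_add_cancel (by omega),
    A.N_iterate] at this
  rw [hpq _ (q.char_mono this (Bool.eq_true_of_not_eq_false hq))] at ha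
  exact Bool.false_ne_true ha.symm

/-- The `tms`-space of prime filters of a tense `m`-symmetric algebra. -/
def spectrum (hm : 1 ≤ m) (A : TmS.{u} m) : TmsSpace.{u} m where
  carrier := LatticeSpectrum A
  g := A.specMap
  RG := LatticeSpectrum.rel A.G
  RH := LatticeSpectrum.rel A.H
  continuous_g := LatticeSpectrum.continuous_iff.2 fun a =>
    (continuous_of_discreteTopology (f := Bool.not)).comp (LatticeSpectrum.continuous_char (A.N a))
  antitone_g p q h a ha := by
    change (!q.char (A.N a)) = true at ha
    change (!p.char (A.N a)) = true
    rw [Bool.not_eq_true'] at ha ⊢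
    by_contra hp
    exact Bool.false_ne_true (ha.symm.trans (h _ (Bool.eq_true_of_not_eq_false hp)))
  isGPRelation_RG := LatticeSpectrum.isGPRelation_rel A.G_top A.G_inf
  isGPRelation_RH := LatticeSpectrum.isGPRelation_rel A.H_top A.H_inf
  g_iterate p := LatticeSpectrum.char_injective <| funext fun a => by
    rw [char_iterate_specMap, A.N_iterate]
  RH_of_RG := A.rel_specMap hm A.le_GNHN
  RG_of_RH := A.rel_specMap hm A.le_HNGN

/-- The representation of an algebra by clopen upper sets of prime filters. -/
def reprHom (hm : 1 ≤ m) (A : TmS.{u} m) : Hom A (TmsSpace.clopenAlgebra hm (A.spectrum hm)) where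
  toHom := LatticeSpectrum.repr
  map_N a := ClopenUpperSet.ext <| Set.ext fun p => by
    change p.char (A.N a) = true ↔ ¬(!p.char (A.N a)) = true
    rw [Bool.not_eq_true', Bool.not_eq_false]
  map_G a := (LatticeSpectrum.box_repr A.G_top A.G_inf a).symm
  map_H a := (LatticeSpectrum.box_repr A.H_top A.H_inf a).symm

/-- A bijective homomorphism is an isomorphism. -/
noncomputable def isoOfBijective {A B : TmS.{u} m} (f : Hom A B)
    (hf : Function.Bijective f.toHom) : A ≅ B :=
  let e := Equiv.ofBijective f.toHom hf
  have he : ∀ b, f.toHom (e.symm b) = b := e.apply_symm_apply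
  { hom := f
    inv :=
      { toHom :=
          { toFun := e.symm
            map_sup' := fun a b => hf.1 ((he _).trans (by rw [map_sup, he, he]))
            map_inf' := fun a b => hf.1 ((he _).trans (by rw [map_inf, he, he]))
            map_top' := hf.1 ((he _).trans (map_top f.toHom).symm)
            map_bot' := hf.1 ((he _).trans (map_bot f.toHom).symm) }
        map_N := fun b => hf.1 ((he _).trans (by
          rw [f.map_N]; exact congrArg B.N (he b).symm))
        map_G := fun b => hf.1 ((he _).trans (by
          rw [f.map_G]; exact congrArg B.G (he b).symm))
        map_H := fun b => hf.1 ((he _).trans (by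
          rw [f.map_H]; exact congrArg B.H (he b).symm)) }
    hom_inv_id := Hom.ext (BoundedLatticeHom.ext e.symm_apply_apply)
    inv_hom_id := Hom.ext (BoundedLatticeHom.ext e.apply_symm_apply) }

instance (hm : 1 ≤ m) : (TmsSpace.clopenFunctor.{u} hm).EssSurj where
  mem_essImage A := ⟨A.unop.spectrum hm, ⟨(isoOfBijective (A.unop.reprHom hm)
    ⟨LatticeSpectrum.repr_injective, LatticeSpectrum.repr_surjective⟩).op⟩⟩

end TmS

theorem theorem3p5 (m : ℕ) (hm : 1 ≤ m) :
    Nonempty ((TmS.{u} m)ᵒᵖ ≌ TmsSpace.{u} m) := by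
  have : (TmsSpace.clopenFunctor.{u} hm).IsEquivalence := {}
  exact ⟨(TmsSpace.clopenFunctor.{u} hm).asEquivalence.symm⟩
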